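/- **Conventions.** All posets are finite. For a poset $P$, the rank $r(t)$ of $t\in P$ is the length of a longest chain with top element $t$, and $r(P)=\max_{t\in P} r(t)$. For a poset $P$ that is empty or has a minimum $\hat 0$ one defines recursively polynomials $f(P,x),g(P,x),h(P,x)\in\mathbb Z[x]$: $f(\emptyset,x)=g(\emptyset,x)=1$, and for $P\neq\emptyset$, with $r=r(P)$, $$f(P,x)=\sum_{t\in P} g([\hat 0,t),x)\,(x-1)^{r-r(t)},\qquad h(P,x)=x^{r}f(P,1/x),$$ $$g(P,x)=f_0+(f_1-f_0)x+\dots+(f_{\lfloor r/2\rfloor}-f_{\lfloor r/2\rfloor-1})x^{\lfloor r/2\rfloor}\quad\text{if } f(P,x)=\sum_i f_i x^i,$$ where $[w,y)=\{z: w\le z<y\}$ and $(w,y]=\{z:w<z\le y\}$. For a poset $P$ with minimum $\hat 0$ let $\widehat P=P\cup\{\hat 1\}$ be $P$ with a new maximum $\hat 1$ added. Let $k$ be a nonzero commutative ring (for instance a field or $\mathbb Z$). $P$ is *Gorenstein\** (over $k$) if $\widehat P$ is Eulerian (graded, and every interval $[a,b]$ with $a<b$ has as many elements of even rank as of odd rank)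 and Cohen–Macaulay over $k$ (for all $a<b$ in $\widehat P$, the reduced homology with coefficients in $k$ of the order complex of the open interval $(a,b)$ vanishes in all degrees below its dimension). An *ideal* of $P$ is a subset closed under passing to smaller elements. For an ideal $I$ of $P$, $\mathrm{Bier}(P,I)$ is the poset of all intervals $[x,y]$ of $\widehat P$ with $x\in I$, $y\in\widehat P- I$, $x\le y$, ordered by reverse inclusion. $X^*$ denotes the opposite of a poset $X$. **Lemma 3.1.** Let $P$ be a Gorenstein\* poset, let $Q\ne\{\hat 0\}$ be an ideal of $P$, and let $t$ be a maximal element of $Q$. Then $$h(\mathrm{Bier}(P,Q-\{t\}),x)-h(\mathrm{Bier}(P,Q),x)=h([\hat 0,t),x)\,g((t,\hat 1]^*,x)-g([\hat 0,t),x)\,h((t,\hat 1]^*,x),$$ where $(t,\hat 1]$ is taken in $\widehat P$. In particular, the left-hand side does not depend on $Q$: if $Q$ and $Q'$ are ideals of $P$ and $t$ is a maximal element of both, then $h(\mathrm{Bier}(P,Q-\{t\}),x)-h(\mathrm{Bier}(P,Q),x)=h(\mathrm{Bier}(P,Q'-\{t\}),x)-h(\mathrm{Bier}(P,Q'),x)$.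 -/

import Mathlib

open Polynomial

universe u v

noncomputable section

/-- The rank `r(t)` of an element: the length of a longest chain with top element `t`
(so a minimum has rank `0`). -/
def elemRank {P : Type u} [PartialOrder P] (t : P) : ℕ := (Order.height t).toNat

/-- The rank `r(P)` of a finite poset: the length of a longest chain, which is the largest rank of
an element (and `0`, by convention, for the empty poset). -/
def posetRank (P : Type u) [PartialOrder P] : ℕ := ⨆ t : P, elemRank t

/-- For `f = h₀ + h₁ x + h₂ x² + ⋯` this is
`h₀ + (h₁ - h₀) x + ⋯ + (h_m - h_{m-1}) x ^ m`, where `m = ⌊r / 2⌋`. -/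
def gOf (r : ℕ) (f : ℤ[X]) : ℤ[X] :=
  C (f.coeff 0) + ∑ i ∈ Finset.Icc 1 (r / 2), C (f.coeff i - f.coeff (i - 1)) * X ^ i

lemma card_Iio_lt {P : Type u} [PartialOrder P] [Finite P] (t : P) :
    Nat.card (Set.Iio t) < Nat.card P :=
  Finite.card_subtype_lt (x := t) (lt_irrefl t)

open Classical in
/-- The polynomial `f(P, x)` of a finite poset `P` with a minimum `0̂`:
`f(∅, x) = 1` and `f(P, x) = ∑ t, g([0̂, t), x) (x - 1) ^ (r(P) - r(t))`, where `g` is obtained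
from `f` by `gOf`. Here `[0̂, t)` is the subposet of all elements smaller than `t`. -/
def toricF (P : Type u) [PartialOrder P] [Finite P] : ℤ[X] :=
  if IsEmpty P then 1
  else ∑ᶠ t : P, gOf (posetRank (Set.Iio t)) (toricF (Set.Iio t)) *
    (X - 1) ^ (posetRank P - elemRank t)
termination_by Nat.card P
decreasing_by exact card_Iio_lt t

/-- The toric `g`-polynomial `g(P, x)`. -/
def toricG (P : Type u) [PartialOrder P] [Finite P] : ℤ[X] := gOf (posetRank P) (toricF P)

/-- The toric `h`-polynomial `h(P, x) = x ^ r f(P, 1 / x)`, with `r = r(P)`. (The degree of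
`f(P, x)` is at most `r`, so that reversing the coefficients within degree `r` is the same.) -/
def toricH (P : Type u) [PartialOrder P] [Finite P] : ℤ[X] := (toricF P).reflect (posetRank P)

/-- The Bier poset `Bier(P, I)`: all intervals `[x, y]` of `P̂ = P ∪ {1̂}` with `x ∈ I` and
`y ∈ P̂ - I`, ordered by reverse inclusion. (`NonemptyInterval` is ordered by inclusion.) -/
abbrev Bier (P : Type u) [PartialOrder P] (I : Set P) : Type u :=
  {s : (NonemptyInterval (WithTop P))ᵒᵈ //
    (OrderDual.ofDual s).fst ∈ ((↑) : P → WithTop P) '' I ∧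
    (OrderDual.ofDual s).snd ∉ ((↑) : P → WithTop P) '' I}

instance finite_nonemptyInterval (A : Type u) [LE A] [Finite A] : Finite (NonemptyInterval A) :=
  Finite.of_injective NonemptyInterval.toProd (NonemptyInterval.toProd_injective)

instance finite_withTop (A : Type u) [Finite A] : Finite (WithTop A) :=
  inferInstanceAs (Finite (Option A))

/-- A bounded poset is Eulerian if it is graded (the rank increases by one along each cover
relation) and in every interval `[a, b]`, `a < b`, there are as many elements of even rank as
there are elements of odd rank. -/
structure IsEulerian (A : Type u) [PartialOrder A] [BoundedOrder A] : Prop where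
  finite : Finite A
  graded : ∀ a b : A, a ⋖ b → elemRank b = elemRank a + 1
  balanced : ∀ a b : A, a < b →
    {z ∈ Set.Icc a b | Even (elemRank z)}.ncard = {z ∈ Set.Icc a b | Odd (elemRank z)}.ncard

/-- The boundary map of the augmented simplicial chain complex, over `k`, of the order complex of
the poset `A`. The faces with `n` vertices (of dimension `n - 1`) are the chains
`a₀ < ⋯ < a_{n-1}`; for `n = 0` this is the empty face. -/
def chainBoundary (k : Type v) [CommRing k] (A : Type u) [PartialOrder A] (n : ℕ) :
    ((Fin (n + 1) ↪o A) →₀ k) →ₗ[k] ((Fin n ↪o A) →₀ k) :=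
  Finsupp.lift ((Fin n ↪o A) →₀ k) k (Fin (n + 1) ↪o A) fun c =>
    ∑ i : Fin (n + 1), Finsupp.single ((Fin.succAboveOrderEmb i).trans c) ((-1 : k) ^ (i : ℕ))

/-- `ReducedHomologyVanishes k A n` says that the reduced simplicial homology in degree `n - 1`,
over `k`, of the order complex of `A` is zero. -/
def ReducedHomologyVanishes (k : Type v) [CommRing k] (A : Type u) [PartialOrder A] : ℕ → Prop
  | 0 => LinearMap.range (chainBoundary k A 0) = ⊤
  | n + 1 => LinearMap.ker (chainBoundary k A n) ≤ LinearMap.range (chainBoundary k A (n + 1))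

/-- A bounded poset is Cohen-Macaulay over `k` if for each open interval `(a, b)` the reduced
homology over `k` of its order complex is zero in all degrees below the dimension of that complex.
(Degree `n - 1` is below the dimension iff there is a chain of `n + 1` elements in `(a, b)`.) -/
def IsCohenMacaulayPoset (k : Type v) [CommRing k] (A : Type u) [PartialOrder A]
    [BoundedOrder A] : Prop :=
  ∀ a b : A, a < b → ∀ n : ℕ, Nonempty (Fin (n + 1) ↪o Set.Ioo a b) →
    ReducedHomologyVanishes k (Set.Ioo a b) n

/-- A poset `P` with a minimum is Gorenstein* over `k` if `P̂ = P ∪ {1̂}` is Eulerian and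
Cohen-Macaulay over `k`. -/
structure IsGorensteinStar (k : Type v) [CommRing k] (P : Type u) [PartialOrder P]
    [OrderBot P] : Prop where
  eulerian : IsEulerian (WithTop P)
  cohenMacaulay : IsCohenMacaulayPoset k (WithTop P)

end

noncomputable section

/-! ### Ranks in finite posets -/

section Rank

/-! Sending [x, y] to (x, y) realises Bier(P, Q) as a lower set of P̂ × P̂*, so its ranks and lower
intervals are those of the product. Since g is multiplicative on products of Eulerian posets
(`toricG_Iio_prod`), f(Bier(P, Q)) is the sum of g([0̂,x)) g((y,1̂]*) (X-1)^(r(y)-1-r(x)) over x ∈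
Q, y ∉ Q, x ≤ y (`toricF_bier`). Removing t from Q gains the pairs (x, t) with x < t and loses the
pairs (t, y) with t < y, so the f-polynomials differ by F G' - G F', where F, G belong to [0̂,t) and
F', G' to (t,1̂]*.

To pass from f to h, reverse coefficients. F and F' are palindromic, while reversing G in degree
r(t) gives (X-1)F + G, and likewise for G'; the cross terms (X-1)FF' cancel. Both the palindromicity
and the multiplicativity rest on the Kazhdan–Lusztig–Stanley identity `stanleySum_eq_reflect`, which
together with the degree bound determines g. -/

lemma coe_elemRank {A : Type*} [PartialOrder A] [Finite A] (a : A) :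
    (elemRank a : ℕ∞) = Order.height a := by
  have := Fintype.ofFinite A
  refine ENat.natCast_toNat (ne_top_of_le_ne_top (ENat.natCast_ne_top (Fintype.card A)) ?_)
  exact Order.height_le fun p _ => by exact_mod_cast (LTSeries.length_lt_card p).le

lemma elemRank_lt {A : Type*} [PartialOrder A] [Finite A] {a b : A} (h : a < b) :
    elemRank a < elemRank b := by
  have := Order.height_add_one_le h
  rw [← coe_elemRank, ← coe_elemRank] at this
  exact_mod_cast this

lemma elemRank_mono {A : Type*} [PartialOrder A] [Finite A] {a b : A} (h : a ≤ b) :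
    elemRank a ≤ elemRank b := by
  rcases h.eq_or_lt with rfl | h
  exacts [le_rfl, (elemRank_lt h).le]

lemma exists_lt_elemRank_eq {A : Type*} [PartialOrder A] [Finite A] {a : A}
    (h : elemRank a ≠ 0) : ∃ b < a, elemRank a = elemRank b + 1 := by
  obtain ⟨n, hn⟩ := Nat.exists_eq_succ_of_ne_zero h
  have h1 := coe_elemRank a
  rw [hn] at h1
  obtain ⟨-, ⟨b, hb, hbn⟩, -⟩ := Order.height_eq_coe_add_one_iff.1 h1.symm
  rw [← coe_elemRank] at hbn
  exact ⟨b, hb, by rw [hn, ← Nat.cast_inj.1 hbn]⟩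

/-- A rank function is determined by being strictly monotone and decreasing by one somewhere
below each element of nonzero rank. -/
lemma elemRank_eq_of_strictMono {A : Type*} [PartialOrder A] [Finite A] {ρ : A → ℕ}
    (hρ : StrictMono ρ) (hρ' : ∀ a, ρ a ≠ 0 → ∃ b < a, ρ a = ρ b + 1) (a : A) :
    elemRank a = ρ a := by
  induction a using WellFoundedLT.induction with
  | ind a ih =>
    apply le_antisymm
    · by_contra! h
      obtain ⟨b, hb, hab⟩ := exists_lt_elemRank_eq (a := a) (by omega)
      have := hρ hb
      have := ih b hb
      omega
    · by_contra! h
      obtain ⟨b, hb, hab⟩ := hρ' a (by omega)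
      have := elemRank_lt hb
      have := ih b hb
      omega

lemma elemRank_eq_zero_of_isMin {A : Type*} [PartialOrder A] [Finite A] {a : A} (h : IsMin a) :
    elemRank a = 0 := by
  by_contra h0
  obtain ⟨b, hb, -⟩ := exists_lt_elemRank_eq h0
  exact h.not_lt hb

lemma elemRank_pos {A : Type*} [PartialOrder A] [Finite A] {a : A} (h : ¬ IsMin a) :
    0 < elemRank a := by
  obtain ⟨b, hb⟩ := not_isMin_iff.1 h
  exact (Nat.zero_le _).trans_lt (elemRank_lt hb)

/-- A chain with top in a lower set never leaves it. -/
lemma elemRank_orderEmbedding {A B : Type*} [PartialOrder A] [PartialOrder B] [Finite A] [Finite B]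
    (φ : A ↪o B) (hφ : IsLowerSet (Set.range φ)) (a : A) : elemRank a = elemRank (φ a) := by
  refine elemRank_eq_of_strictMono (ρ := fun a => elemRank (φ a))
    (fun x y h => elemRank_lt (φ.strictMono h)) (fun x hx => ?_) a
  obtain ⟨b, hb, hab⟩ := exists_lt_elemRank_eq hx
  obtain ⟨y, rfl⟩ := hφ hb.le ⟨x, rfl⟩
  exact ⟨y, φ.lt_iff_lt.1 hb, hab⟩

lemma isLowerSet_range_orderIso {A B : Type*} [PartialOrder A] [PartialOrder B] (e : A ≃o B) :
    IsLowerSet (Set.range e.toOrderEmbedding) :=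
  fun _ b _ _ => ⟨e.symm b, e.apply_symm_apply b⟩

lemma elemRank_orderIso {A B : Type*} [PartialOrder A] [PartialOrder B] [Finite A] [Finite B]
    (e : A ≃o B) (a : A) : elemRank (e a) = elemRank a :=
  (elemRank_orderEmbedding e.toOrderEmbedding (isLowerSet_range_orderIso e) a).symm

lemma elemRank_prod {A B : Type*} [PartialOrder A] [PartialOrder B] [Finite A] [Finite B]
    (p : A × B) : elemRank p = elemRank p.1 + elemRank p.2 := by
  refine elemRank_eq_of_strictMono (ρ := fun p : A × B => elemRank p.1 + elemRank p.2)
    (fun p q h => ?_) (fun p hp => ?_) p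
  · rcases Prod.lt_iff.1 h with ⟨h1, h2⟩ | ⟨h1, h2⟩
    · exact add_lt_add_of_lt_of_le (elemRank_lt h1) (elemRank_mono h2)
    · exact add_lt_add_of_le_of_lt (elemRank_mono h1) (elemRank_lt h2)
  · by_cases h1 : elemRank p.1 = 0
    · obtain ⟨b, hb, hab⟩ := exists_lt_elemRank_eq (a := p.2) (by simpa [h1] using hp)
      exact ⟨(p.1, b), Prod.lt_iff.2 (Or.inr ⟨le_rfl, hb⟩), by simp only; omega⟩
    · obtain ⟨b, hb, hab⟩ := exists_lt_elemRank_eq h1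
      exact ⟨(b, p.2), Prod.lt_iff.2 (Or.inl ⟨hb, le_rfl⟩), by simp only; omega⟩

lemma posetRank_eq {A : Type*} [PartialOrder A] [Finite A] {n : ℕ}
    (h : ∀ a : A, elemRank a ≤ n) (h' : ∃ a : A, elemRank a = n) : posetRank A = n := by
  obtain ⟨a, rfl⟩ := h'
  have : Nonempty A := ⟨a⟩
  exact le_antisymm (ciSup_le h) (le_ciSup (f := fun t : A => elemRank t) (Set.finite_range _).bddAbove a)

lemma posetRank_of_isEmpty (A : Type*) [PartialOrder A] [IsEmpty A] : posetRank A = 0 := by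
  simp [posetRank]

lemma posetRank_orderIso {A B : Type*} [PartialOrder A] [PartialOrder B] [Finite A] [Finite B]
    (e : A ≃o B) : posetRank A = posetRank B :=
  Equiv.iSup_congr e.toEquiv fun a => elemRank_orderIso e a

/-- The inclusion of `Iio a`. -/
def iioEmbedding {A : Type*} [PartialOrder A] (a : A) : Set.Iio a ↪o A := OrderEmbedding.subtype _

lemma range_iioEmbedding {A : Type*} [PartialOrder A] (a : A) :
    Set.range (iioEmbedding a) = Set.Iio a := Subtype.range_coe

lemma isLowerSet_range_iioEmbedding {A : Type*} [PartialOrder A] (a : A) :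
    IsLowerSet (Set.range (iioEmbedding a)) := by
  rw [range_iioEmbedding]; exact isLowerSet_Iio a

/-- For minimal `a`, truncated subtraction agrees with the convention that the empty poset has rank
0. -/
lemma posetRank_Iio {A : Type*} [PartialOrder A] [Finite A] (a : A) :
    posetRank (Set.Iio a) = elemRank a - 1 := by
  by_cases h : IsMin a
  · have : IsEmpty (Set.Iio a) := ⟨fun x => h.not_lt x.2⟩
    rw [posetRank_of_isEmpty, elemRank_eq_zero_of_isMin h]
  · have hr (b : Set.Iio a) : elemRank b = elemRank (b : A) :=
      elemRank_orderEmbedding (iioEmbedding a) (isLowerSet_range_iioEmbedding a) b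
    refine posetRank_eq (fun b => ?_) ?_
    · have := elemRank_lt (show (b : A) < a from b.2)
      rw [hr]
      omega
    · obtain ⟨b, hb, hab⟩ := exists_lt_elemRank_eq (elemRank_pos h).ne'
      exact ⟨⟨b, hb⟩, by rw [hr]; simp only; omega⟩

/-- An embedding onto a lower set restricts to isomorphisms of principal lower sets. -/
def OrderEmbedding.iioIso {A B : Type*} [PartialOrder A] [PartialOrder B] (φ : A ↪o B)
    (hφ : IsLowerSet (Set.range φ)) (a : A) : Set.Iio a ≃o Set.Iio (φ a) where
  toEquiv := Equiv.ofBijective (fun x => ⟨φ x, φ.lt_iff_lt.2 x.2⟩)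
    ⟨fun x y h => Subtype.ext (φ.injective (congrArg Subtype.val h)), fun y => by
      obtain ⟨x, hx⟩ := hφ y.2.le ⟨a, rfl⟩
      exact ⟨⟨x, φ.lt_iff_lt.1 (hx ▸ y.2)⟩, Subtype.ext hx⟩⟩
  map_rel_iff' := φ.le_iff_le

end Rank

/-! ### The truncation `gOf` -/

section Truncation

/-- Taking successive differences of coefficients is multiplication by 1 - X, so `gOf` is a
truncation of (1 - X) f. -/
lemma coeff_gOf (r : ℕ) (f : ℤ[X]) (i : ℕ) :
    (gOf r f).coeff i = if i ≤ r / 2 then ((1 - X) * f).coeff i else 0 := by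
  rw [gOf, coeff_add, finsetSum_coeff]
  simp only [coeff_C_mul_X_pow]
  rw [Finset.sum_ite_eq]
  rcases i with - | i
  · simp [sub_mul]
  · rw [coeff_C_succ]; simp [sub_mul, coeff_X_mul]

lemma natDegree_gOf_le (r : ℕ) (f : ℤ[X]) : (gOf r f).natDegree ≤ r / 2 := by
  refine natDegree_le_iff_coeff_eq_zero.2 fun i hi => ?_
  rw [coeff_gOf, if_neg (by omega)]

lemma reflect_neg' (N : ℕ) (f : ℤ[X]) : (-f).reflect N = -f.reflect N := by
  ext; simp

lemma reflect_sub' (N : ℕ) (f g : ℤ[X]) : (f - g).reflect N = f.reflect N - g.reflect N := by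
  ext; simp

lemma reflect_sum {ι : Type*} (N : ℕ) (s : Finset ι) (f : ι → ℤ[X]) :
    (∑ i ∈ s, f i).reflect N = ∑ i ∈ s, (f i).reflect N := by
  ext; simp

lemma natDegree_X_sub_one_pow_le (m : ℕ) : ((X - 1 : ℤ[X]) ^ m).natDegree ≤ m := by
  simpa using natDegree_pow_le_of_le m (natDegree_X_sub_C (1 : ℤ)).le

lemma reflect_X_sub_one_pow (m : ℕ) : ((X - 1 : ℤ[X]) ^ m).reflect m = (-1) ^ m * (X - 1) ^ m := by
  induction m with
  | zero => simp
  | succ m ih =>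
    have h1 : (X - 1 : ℤ[X]).reflect 1 = - (X - 1) := by
      rw [reflect_sub', reflect_one_X, reflect_one]; ring
    rw [pow_succ, reflect_mul _ _ (natDegree_X_sub_one_pow_le m)
      (by simpa using natDegree_X_sub_one_pow_le 1), ih, h1]
    ring

/-- For palindromic `f`, the polynomial `g` is the Kazhdan–Lusztig–Stanley truncation. -/
lemma X_sub_one_mul_add_gOf {r : ℕ} {f : ℤ[X]} (hd : f.natDegree ≤ r) (hf : f.reflect r = f) :
    (X - 1) * f + gOf r f = (gOf r f).reflect (r + 1) := by
  have hanti : ((1 - X) * f).reflect (r + 1) = -((1 - X) * f) := by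
    have : (1 - X) * f = -(f * (X - 1) ^ 1) := by ring
    rw [this, reflect_neg', reflect_mul _ _ hd (natDegree_X_sub_one_pow_le 1), hf,
      reflect_X_sub_one_pow]
    ring
  have hdeg : ((1 - X) * f).natDegree ≤ r + 1 := by
    have : (1 - X) * f = -(f * (X - 1) ^ 1) := by ring
    rw [this, natDegree_neg]
    exact natDegree_mul_le_of_le hd (natDegree_X_sub_one_pow_le 1)
  have hneg : (X - 1) * f = -((1 - X) * f) := by ring
  -- By `hanti`, (1 - X) f is antisymmetric about degree (r + 1)/2, and `gOf` is its lower half; the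
  -- upper half is minus the reversal of the lower one.
  rw [hneg]
  generalize hp : (1 - X) * f = p at *
  ext i
  have hi := congrArg (fun q => coeff q i) hanti
  simp only [coeff_reflect, coeff_neg] at hi
  rw [coeff_add, coeff_neg, coeff_reflect, coeff_gOf, coeff_gOf, hp]
  rcases le_or_gt i (r + 1) with h | h
  · rw [revAt_le h] at hi ⊢
    split_ifs with h1 h2 h2
    · omega
    · ring
    · linarith
    -- Only the middle degree lies in neither half, and antisymmetry makes its coefficient zero.
    · have : r + 1 - i = i := by omega
      rw [this] at hi
      linarith
  · rw [revAt_eq_self_of_lt h, if_neg (by omega), coeff_eq_zero_of_natDegree_lt (by omega)]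
    simp

/-- Uniqueness in the Kazhdan–Lusztig–Stanley identity: `q` and its reversal occupy disjoint ranges
of degrees, so `q` is recovered by truncating. -/
lemma gOf_eq_of_X_sub_one_mul_add_eq {r : ℕ} {f q : ℤ[X]}
    (h : (X - 1) * f + q = q.reflect (r + 1)) (hq : q.natDegree ≤ r / 2) : gOf r f = q := by
  have hp : (1 - X) * f = q - q.reflect (r + 1) := by rw [← h]; ring
  ext i
  rw [coeff_gOf, hp, coeff_sub, coeff_reflect]
  split_ifs with hi
  · rw [revAt_le (by omega), coeff_eq_zero_of_natDegree_lt (n := r + 1 - i) (by omega), sub_zero]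
  · exact (coeff_eq_zero_of_natDegree_lt (by omega)).symm

end Truncation

/-! ### Toric polynomials of lower intervals -/

section Toric

lemma toricF_of_isEmpty (P : Type u) [PartialOrder P] [Finite P] [h : IsEmpty P] :
    toricF P = 1 := by
  rw [toricF, if_pos h]

lemma toricG_of_isEmpty (P : Type u) [PartialOrder P] [Finite P] [h : IsEmpty P] :
    toricG P = 1 := by
  simp [toricG, toricF_of_isEmpty, posetRank_of_isEmpty, gOf]

lemma toricF_eq_sum (P : Type u) [PartialOrder P] [Fintype P] [h : Nonempty P] :
    toricF P = ∑ t : P, toricG (Set.Iio t) * (X - 1) ^ (posetRank P - elemRank t) := by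
  rw [toricF, if_neg (not_isEmpty_iff.2 h), finsum_eq_sum_of_fintype]
  rfl

/-- The recursion for f changes the type to `Set.Iio a`, so the induction runs over a bound on the
cardinality, for all posets at once. -/
lemma toricF_orderIso_of_card (n : ℕ) : ∀ {A B : Type u} [PartialOrder A] [PartialOrder B]
    [Finite A] [Finite B], Nat.card A ≤ n → (A ≃o B) → toricF A = toricF B := by
  induction n with
  | zero =>
    intro A B _ _ _ _ hn e
    have : IsEmpty A := (Nat.card_eq_zero.1 (Nat.le_zero.1 hn)).resolve_right fun h =>
      h.not_finite ‹_›
    have : IsEmpty B := e.symm.toEquiv.isEmpty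
    rw [toricF_of_isEmpty, toricF_of_isEmpty]
  | succ n ih =>
    intro A B _ _ _ _ hn e
    rcases isEmpty_or_nonempty A with hA | hA
    · have : IsEmpty B := e.symm.toEquiv.isEmpty
      rw [toricF_of_isEmpty, toricF_of_isEmpty]
    · have := Fintype.ofFinite A
      have := Fintype.ofFinite B
      have : Nonempty B := hA.map e
      rw [toricF_eq_sum, toricF_eq_sum]
      refine Fintype.sum_equiv e.toEquiv _ _ fun a => ?_
      have ea := OrderEmbedding.iioIso e.toOrderEmbedding (isLowerSet_range_orderIso e) a
      change Set.Iio a ≃o Set.Iio (e a) at ea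
      change _ = toricG (Set.Iio (e a)) * (X - 1) ^ (posetRank B - elemRank (e a))
      rw [posetRank_orderIso e, elemRank_orderIso e, toricG, toricG, posetRank_orderIso ea,
        ih (by have := card_Iio_lt a; omega) ea]

lemma toricF_orderIso {A B : Type u} [PartialOrder A] [PartialOrder B] [Finite A] [Finite B]
    (e : A ≃o B) : toricF A = toricF B :=
  toricF_orderIso_of_card _ le_rfl e

lemma toricG_orderIso {A B : Type u} [PartialOrder A] [PartialOrder B] [Finite A] [Finite B]
    (e : A ≃o B) : toricG A = toricG B := by
  rw [toricG, toricG, toricF_orderIso e, posetRank_orderIso e]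

lemma toricH_orderIso {A B : Type u} [PartialOrder A] [PartialOrder B] [Finite A] [Finite B]
    (e : A ≃o B) : toricH A = toricH B := by
  rw [toricH, toricH, toricF_orderIso e, posetRank_orderIso e]

open Classical in
/-- The polynomial `f` of a poset that is embedded as a lower set in another one. -/
lemma toricF_eq_sum_of_orderEmbedding {A B : Type u} [PartialOrder A] [PartialOrder B] [Finite A]
    [Fintype B] [Nonempty A] (φ : A ↪o B) (hφ : IsLowerSet (Set.range φ)) :
    toricF A = ∑ b : B with b ∈ Set.range φ,
      toricG (Set.Iio b) * (X - 1) ^ (posetRank A - elemRank b) := by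
  have := Fintype.ofFinite A
  rw [toricF_eq_sum]
  refine Eq.trans ?_ (Finset.sum_congr (s₁ := Finset.univ.map φ.toEmbedding) (by ext; simp)
    fun _ _ => rfl)
  rw [Finset.sum_map]
  refine Finset.sum_congr rfl fun a _ => ?_
  rw [elemRank_orderEmbedding φ hφ a, toricG_orderIso (φ.iioIso hφ a)]
  rfl

open Classical in
lemma toricF_Iio {A : Type u} [PartialOrder A] [Fintype A] {a : A} (ha : ¬ IsMin a) :
    toricF (Set.Iio a) = ∑ b : A with b < a,
      toricG (Set.Iio b) * (X - 1) ^ (elemRank a - 1 - elemRank b) := by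
  have : Nonempty (Set.Iio a) := by
    obtain ⟨b, hb⟩ := not_isMin_iff.1 ha
    exact ⟨⟨b, hb⟩⟩
  rw [toricF_eq_sum_of_orderEmbedding (iioEmbedding a) (isLowerSet_range_iioEmbedding a),
    range_iioEmbedding, posetRank_Iio]
  rfl

open Classical in
/-- The sum `∑ g([0̂, b), x) (x - 1) ^ (r(a) - r(b))` over all `b ≤ a`. -/
def stanleySum {A : Type u} [PartialOrder A] [Fintype A] (a : A) : ℤ[X] :=
  ∑ b : A with b ≤ a, toricG (Set.Iio b) * (X - 1) ^ (elemRank a - elemRank b)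

lemma filter_le_eq_insert {A : Type*} [PartialOrder A] [Fintype A] [DecidableEq A] (a : A)
    [∀ b, Decidable (b ≤ a)] [∀ b, Decidable (b < a)] :
    ({b | b ≤ a} : Finset A) = insert a ({b | b < a} : Finset A) := by
  ext b
  simp [le_iff_eq_or_lt]

open Classical in
-- The term b = a contributes g; each other term has one more factor X - 1 than in f([0̂, a)), whose
-- rank is r(a) - 1.
lemma stanleySum_eq {A : Type u} [PartialOrder A] [Fintype A] {a : A} (ha : ¬ IsMin a) :
    stanleySum a = (X - 1) * toricF (Set.Iio a) + toricG (Set.Iio a) := by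
  rw [stanleySum, toricF_Iio ha, filter_le_eq_insert, Finset.sum_insert (by simp), add_comm,
    Finset.mul_sum]
  simp only [Nat.sub_self, pow_zero, mul_one]
  congr 1
  refine Finset.sum_congr rfl fun b hb => ?_
  have := elemRank_lt (Finset.mem_filter.1 hb).2
  rw [show elemRank a - elemRank b = elemRank a - 1 - elemRank b + 1 by omega]
  ring

lemma isEmpty_Iio_of_isMin {A : Type*} [PartialOrder A] {a : A} (ha : IsMin a) :
    IsEmpty (Set.Iio a) := ⟨fun x => ha.not_lt x.2⟩

lemma toricG_Iio_of_isMin {A : Type u} [PartialOrder A] [Finite A] {a : A} (ha : IsMin a) :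
    toricG (Set.Iio a) = 1 :=
  have := isEmpty_Iio_of_isMin ha
  toricG_of_isEmpty _

lemma natDegree_toricG_Iio_le {A : Type u} [PartialOrder A] [Finite A] (a : A) :
    (toricG (Set.Iio a)).natDegree ≤ (elemRank a - 1) / 2 := by
  rw [← posetRank_Iio]
  exact natDegree_gOf_le _ _

lemma natDegree_toricF_Iio_le {A : Type u} [PartialOrder A] [Fintype A] {a : A}
    (ha : ¬ IsMin a) : (toricF (Set.Iio a)).natDegree ≤ elemRank a - 1 := by
  classical
  rw [toricF_Iio ha]
  refine natDegree_sum_le_of_forall_le _ _ fun b hb => ?_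
  have := elemRank_lt (Finset.mem_filter.1 hb).2
  refine (natDegree_mul_le_of_le (natDegree_toricG_Iio_le b)
    (natDegree_X_sub_one_pow_le _)).trans ?_
  omega

end Toric

/-! ### Palindromicity for Eulerian posets -/

section Eulerian

open Classical in
/-- Each interval with at least two elements has as many elements of even as of odd rank. -/
def IsLocallyEulerian (A : Type*) [PartialOrder A] [Fintype A] : Prop :=
  ∀ a b : A, a < b → ∑ z : A with a ≤ z ∧ z ≤ b, (-1 : ℤ) ^ elemRank z = 0

open Classical in
-- Split the top term off the alternating sum and normalise signs by that of `b`.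
lemma IsLocallyEulerian.sum_filter_lt {A : Type*} [PartialOrder A] [Fintype A]
    (hA : IsLocallyEulerian A) {a b : A} (hab : a < b) :
    ∑ z : A with a ≤ z ∧ z < b, (-1 : ℤ) ^ (elemRank b - elemRank z) = -1 := by
  have h := hA a b hab
  have hins : ({z | a ≤ z ∧ z ≤ b} : Finset A) = insert b ({z | a ≤ z ∧ z < b} : Finset A) := by
    ext z
    simp only [Finset.mem_filter, Finset.mem_univ, true_and, Finset.mem_insert]
    constructor
    · rintro ⟨h1, h2⟩
      exact h2.eq_or_lt.imp id fun h => ⟨h1, h⟩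
    · rintro (rfl | ⟨h1, h2⟩)
      exacts [⟨hab.le, le_rfl⟩, ⟨h1, h2.le⟩]
  rw [hins, Finset.sum_insert (by simp)] at h
  have hsq : (-1 : ℤ) ^ elemRank b * (-1) ^ elemRank b = 1 := by
    rw [← mul_pow]; simp
  have : ∀ z ∈ ({z | a ≤ z ∧ z < b} : Finset A),
      (-1 : ℤ) ^ (elemRank b - elemRank z) = (-1) ^ elemRank b * (-1) ^ elemRank z := by
    intro z hz
    have hzb := elemRank_lt (Finset.mem_filter.1 hz).2.2
    obtain ⟨m, hm⟩ := Nat.exists_eq_add_of_le hzb.le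
    have hsq : (-1 : ℤ) ^ elemRank z * (-1) ^ elemRank z = 1 := by
      rw [← mul_pow]; simp
    rw [hm, Nat.add_sub_cancel_left, pow_add]
    linear_combination (-(-1 : ℤ) ^ m) * hsq
  rw [Finset.sum_congr rfl this, ← Finset.mul_sum, eq_neg_of_add_eq_zero_right h]
  linear_combination -hsq

/-- If the Kazhdan–Lusztig–Stanley identity holds below `a`, then `f([0̂, a), x)` is palindromic. -/
lemma IsLocallyEulerian.reflect_toricF_of_forall_lt {A : Type u} [PartialOrder A] [Fintype A]
    (hA : IsLocallyEulerian A) {a : A} (ha : ¬ IsMin a)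
    (ih : ∀ b < a, stanleySum b = (toricG (Set.Iio b)).reflect (elemRank b)) :
    (toricF (Set.Iio a)).reflect (elemRank a - 1) = toricF (Set.Iio a) := by
  classical
  have hpos := elemRank_pos ha
  -- Reverse g in degree r(b) and the power of X - 1 in degree r(a) - r(b); the induction hypothesis
  -- expands the reversed g over c ≤ b.
  have hterm : ∀ b ∈ ({b | b < a} : Finset A),
      (toricG (Set.Iio b) * (X - 1) ^ (elemRank a - elemRank b)).reflect (elemRank a) =
      ∑ c : A with c ≤ b, (-1) ^ (elemRank a - elemRank b) *
        (toricG (Set.Iio c) * (X - 1) ^ (elemRank a - elemRank c)) := by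
    intro b hb
    have hba := (Finset.mem_filter.1 hb).2
    have hr := elemRank_lt hba
    have := reflect_mul (toricG (Set.Iio b)) ((X - 1 : ℤ[X]) ^ (elemRank a - elemRank b))
      (F := elemRank b) (G := elemRank a - elemRank b)
      ((natDegree_toricG_Iio_le b).trans (by omega)) (natDegree_X_sub_one_pow_le _)
    rw [Nat.add_sub_cancel' hr.le] at this
    rw [this, ← ih b hba, stanleySum, Finset.sum_mul, reflect_X_sub_one_pow]
    refine Finset.sum_congr rfl fun c hc => ?_
    have hcb := elemRank_mono (Finset.mem_filter.1 hc).2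
    rw [show elemRank a - elemRank c = (elemRank b - elemRank c) + (elemRank a - elemRank b) by
      omega, pow_add]
    ring
  have hmul : (X - 1) * toricF (Set.Iio a) =
      ∑ b : A with b < a, toricG (Set.Iio b) * (X - 1) ^ (elemRank a - elemRank b) := by
    have h := stanleySum_eq ha
    rw [stanleySum, filter_le_eq_insert, Finset.sum_insert (by simp)] at h
    simp only [Nat.sub_self, pow_zero, mul_one] at h
    linear_combination -h
  have hanti : ((X - 1) * toricF (Set.Iio a)).reflect (elemRank a) =
      -((X - 1) * toricF (Set.Iio a)) := by
    rw [hmul, reflect_sum, Finset.sum_congr rfl hterm,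
      Finset.sum_comm' (t' := ({c | c < a} : Finset A))
        (s' := fun c => ({b | c ≤ b ∧ b < a} : Finset A)), ← Finset.sum_neg_distrib]
    -- After exchanging the sums, the signs attached to a fixed `c` add up to -1 by the Eulerian
    -- condition.
    · refine Finset.sum_congr rfl fun c hc => ?_
      have h := congrArg (Int.cast : ℤ → ℤ[X]) (hA.sum_filter_lt (Finset.mem_filter.1 hc).2)
      push_cast at h
      rw [← Finset.sum_mul, h]
      ring
    · intro b c
      simp only [Finset.mem_filter, Finset.mem_univ, true_and]
      exact ⟨fun h => ⟨⟨h.2, h.1⟩, h.2.trans_lt h.1⟩, fun h => ⟨h.1.2, h.1.1⟩⟩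
  -- X - 1 is itself antipalindromic, so cancelling it leaves f palindromic.
  have hr := reflect_mul ((X - 1 : ℤ[X]) ^ 1) (toricF (Set.Iio a)) (F := 1)
    (G := elemRank a - 1) (natDegree_X_sub_one_pow_le 1) (natDegree_toricF_Iio_le ha)
  rw [Nat.add_sub_cancel' hpos, reflect_X_sub_one_pow, pow_one, pow_one, hanti] at hr
  have hne : (X - 1 : ℤ[X]) ≠ 0 := by simpa using X_sub_C_ne_zero (1 : ℤ)
  apply mul_left_cancel₀ hne
  linear_combination hr

/-- The Kazhdan–Lusztig–Stanley identity for `g`. -/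
theorem IsLocallyEulerian.stanleySum_eq_reflect {A : Type u} [PartialOrder A] [Fintype A]
    (hA : IsLocallyEulerian A) (a : A) :
    stanleySum a = (toricG (Set.Iio a)).reflect (elemRank a) := by
  classical
  induction a using WellFoundedLT.induction with
  | ind a ih =>
    by_cases ha : IsMin a
    · rw [stanleySum, filter_le_eq_insert, Finset.sum_insert (by simp),
        Finset.filter_false_of_mem fun b _ => ha.not_lt, elemRank_eq_zero_of_isMin ha,
        toricG_Iio_of_isMin ha]
      simp
    · have h := hA.reflect_toricF_of_forall_lt ha ih
      have := X_sub_one_mul_add_gOf (natDegree_toricF_Iio_le ha) h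
      rw [Nat.sub_add_cancel (elemRank_pos ha), ← posetRank_Iio] at this
      rw [stanleySum_eq ha]
      exact this

theorem IsLocallyEulerian.reflect_toricF {A : Type u} [PartialOrder A] [Fintype A]
    (hA : IsLocallyEulerian A) {a : A} (ha : ¬ IsMin a) :
    (toricF (Set.Iio a)).reflect (elemRank a - 1) = toricF (Set.Iio a) :=
  hA.reflect_toricF_of_forall_lt ha fun b _ => hA.stanleySum_eq_reflect b

lemma IsLocallyEulerian.toricH_Iio {A : Type u} [PartialOrder A] [Fintype A]
    (hA : IsLocallyEulerian A) {a : A} (ha : ¬ IsMin a) :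
    toricH (Set.Iio a) = toricF (Set.Iio a) := by
  rw [toricH, posetRank_Iio, hA.reflect_toricF ha]

lemma IsLocallyEulerian.reflect_toricG {A : Type u} [PartialOrder A] [Fintype A]
    (hA : IsLocallyEulerian A) {a : A} (ha : ¬ IsMin a) :
    (toricG (Set.Iio a)).reflect (elemRank a) =
      (X - 1) * toricF (Set.Iio a) + toricG (Set.Iio a) := by
  rw [← hA.stanleySum_eq_reflect, stanleySum_eq ha]

/-- The toric `g`-polynomial is multiplicative. -/
theorem toricG_Iio_prod {A B : Type u} [PartialOrder A] [PartialOrder B] [Fintype A] [Fintype B]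
    (hA : IsLocallyEulerian A) (hB : IsLocallyEulerian B) (p : A × B) :
    toricG (Set.Iio p) = toricG (Set.Iio p.1) * toricG (Set.Iio p.2) := by
  classical
  induction p using WellFoundedLT.induction with
  | ind p ih =>
    obtain ⟨a, b⟩ := p
    simp only at ih ⊢
    by_cases hp : IsMin (a, b)
    · obtain ⟨ha, hb⟩ := Prod.isMin_iff.1 hp
      simp only at ha hb
      rw [toricG_Iio_of_isMin hp, toricG_Iio_of_isMin ha, toricG_Iio_of_isMin hb, one_mul]
    · have hpos := elemRank_pos hp
      have hd1 := natDegree_toricG_Iio_le a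
      have hd2 := natDegree_toricG_Iio_le b
      have hr : elemRank (a, b) = elemRank a + elemRank b := elemRank_prod _
      rw [toricG, posetRank_Iio]
      -- By uniqueness it suffices that the product of the two g-polynomials satisfies the identity
      -- in the product poset; this is the product of the identities in the factors.
      refine gOf_eq_of_X_sub_one_mul_add_eq ?_
        ((natDegree_mul_le_of_le hd1 hd2).trans (by omega))
      rw [Nat.sub_add_cancel hpos, hr, reflect_mul _ _ (by omega) (by omega),
        ← hA.stanleySum_eq_reflect, ← hB.stanleySum_eq_reflect]
      have hf : (X - 1) * toricF (Set.Iio (a, b)) = ∑ q : A × B with q < (a, b),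
          toricG (Set.Iio q.1) * toricG (Set.Iio q.2) *
            (X - 1) ^ (elemRank (a, b) - elemRank q) := by
        rw [toricF_Iio hp, Finset.mul_sum]
        refine Finset.sum_congr rfl fun q hq => ?_
        have hq := (Finset.mem_filter.1 hq).2
        have := elemRank_lt hq
        rw [ih q hq, show elemRank (a, b) - elemRank q =
          elemRank (a, b) - 1 - elemRank q + 1 by omega]
        ring
      have hle : ({q | q ≤ (a, b)} : Finset (A × B)) =
          ({x | x ≤ a} : Finset A) ×ˢ ({y | y ≤ b} : Finset B) := by
        ext q
        simp [Prod.le_def]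
      have hins : (X - 1) * toricF (Set.Iio (a, b)) + toricG (Set.Iio a) * toricG (Set.Iio b) =
          ∑ q : A × B with q ≤ (a, b), toricG (Set.Iio q.1) * toricG (Set.Iio q.2) *
            (X - 1) ^ (elemRank (a, b) - elemRank q) := by
        rw [filter_le_eq_insert, Finset.sum_insert (by simp), hf]
        simp only [Nat.sub_self, pow_zero, mul_one]
        ring
      rw [hins, hle, stanleySum, stanleySum, Finset.sum_mul_sum, Finset.sum_product]
      refine Finset.sum_congr rfl fun x hx => Finset.sum_congr rfl fun y hy => ?_
      have h1 := elemRank_mono (Finset.mem_filter.1 hx).2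
      have h2 := elemRank_mono (Finset.mem_filter.1 hy).2
      rw [hr, elemRank_prod, show elemRank a + elemRank b - (elemRank x + elemRank y) =
        (elemRank a - elemRank x) + (elemRank b - elemRank y) by omega, pow_add]
      ring

end Eulerian

/-! ### Bounded Eulerian posets and their duals -/

section Dual

lemma IsEulerian.isLocallyEulerian {A : Type*} [PartialOrder A] [BoundedOrder A] [Fintype A]
    (hA : IsEulerian A) : IsLocallyEulerian A := by
  classical
  intro a b hab
  have h := hA.balanced a b hab
  rw [Set.ncard_eq_toFinset_card', Set.ncard_eq_toFinset_card'] at h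
  rw [← Finset.sum_filter_add_sum_filter_not _ (fun z => Even (elemRank z)),
    Finset.sum_congr rfl fun z hz => (Finset.mem_filter.1 hz).2.neg_one_pow,
    Finset.sum_congr (g := fun _ => (-1 : ℤ)) rfl fun z hz =>
      (Nat.not_even_iff_odd.1 (Finset.mem_filter.1 hz).2).neg_one_pow]
  simp only [Finset.sum_const, nsmul_eq_mul, mul_one, mul_neg]
  rw [← sub_eq_add_neg, sub_eq_zero]
  refine Eq.trans ?_ ((congrArg (Nat.cast : ℕ → ℤ) h).trans ?_)
  · congr 2; ext z; simp
  · congr 2; ext z; simp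

open OrderDual in
-- By gradedness, stepping up a cover lowers the corank by exactly one.
lemma IsEulerian.elemRank_toDual {A : Type*} [PartialOrder A] [BoundedOrder A] [Finite A]
    (hA : IsEulerian A) (a : A) : elemRank (toDual a) = elemRank (⊤ : A) - elemRank a := by
  refine elemRank_eq_of_strictMono (ρ := fun b : Aᵒᵈ => elemRank (⊤ : A) - elemRank (ofDual b))
    (fun b c h => ?_) (fun b hb => ?_) (toDual a)
  · have h1 := elemRank_lt (show ofDual c < ofDual b from h)
    have h2 := elemRank_mono (le_top (a := ofDual b))
    simp only
    omega
  · have hne : ofDual b ≠ ⊤ := by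
      intro h
      rw [h, Nat.sub_self] at hb
      exact hb rfl
    obtain ⟨c, hc⟩ := exists_covBy_of_wellFoundedLT (not_isMax_iff_ne_top.2 hne)
    have h1 := hA.graded _ _ hc
    have h2 := elemRank_mono (le_top (a := c))
    exact ⟨toDual c, hc.lt, by simp only [ofDual_toDual]; omega⟩

open OrderDual in
-- Dualising multiplies all signs by the global factor (-1)^r(1̂).
lemma IsEulerian.isLocallyEulerian_dual {A : Type*} [PartialOrder A] [BoundedOrder A] [Fintype A]
    [Fintype Aᵒᵈ] (hA : IsEulerian A) : IsLocallyEulerian Aᵒᵈ := by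
  classical
  intro a b hab
  have h := hA.isLocallyEulerian (ofDual b) (ofDual a) hab
  have hterm (z : A) : (-1 : ℤ) ^ elemRank (toDual z) =
      (-1) ^ elemRank (⊤ : A) * (-1) ^ elemRank z := by
    obtain ⟨m, hm⟩ := Nat.exists_eq_add_of_le (elemRank_mono (le_top (a := z)))
    have hsq : (-1 : ℤ) ^ elemRank z * (-1) ^ elemRank z = 1 := by
      rw [← mul_pow]; simp
    rw [hA.elemRank_toDual, hm, Nat.add_sub_cancel_left, pow_add]
    linear_combination (-(-1 : ℤ) ^ m) * hsq
  have hre : ∑ z : Aᵒᵈ with a ≤ z ∧ z ≤ b, (-1 : ℤ) ^ elemRank z =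
      ∑ z : A with ofDual b ≤ z ∧ z ≤ ofDual a, (-1 : ℤ) ^ elemRank (toDual z) := by
    rw [Finset.sum_filter, Finset.sum_filter]
    refine Fintype.sum_equiv ofDual _ _ fun z => ?_
    refine if_congr ?_ rfl rfl
    exact and_comm
  rw [hre, Finset.sum_congr rfl fun z _ => hterm z, ← Finset.mul_sum, h, mul_zero]

end Dual

/-! ### Bier posets -/

section BierPoset

open OrderDual

variable {P : Type u} [PartialOrder P]

/-- The interval `[x, y]` corresponds to the pair `(x, y)`. -/
def bierEmbedding (Q : Set P) : Bier P Q ↪o WithTop P × (WithTop P)ᵒᵈ :=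
  OrderEmbedding.ofMapLEIff (fun s => ((ofDual s.1).fst, toDual (ofDual s.1).snd)) fun _ _ => Iff.rfl

lemma mem_range_bierEmbedding {Q : Set P} {p : WithTop P × (WithTop P)ᵒᵈ} :
    p ∈ Set.range (bierEmbedding Q) ↔ p.1 ∈ ((↑) : P → WithTop P) '' Q ∧
      ofDual p.2 ∉ ((↑) : P → WithTop P) '' Q ∧ p.1 ≤ ofDual p.2 := by
  constructor
  · rintro ⟨s, rfl⟩
    exact ⟨s.2.1, s.2.2, (ofDual s.1).fst_le_snd⟩
  · rintro ⟨h1, h2, h3⟩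
    exact ⟨⟨toDual ⟨(p.1, ofDual p.2), h3⟩, h1, h2⟩, rfl⟩

lemma isLowerSet_image_coe {Q : Set P} (hQ : IsLowerSet Q) :
    IsLowerSet (((↑) : P → WithTop P) '' Q) := by
  rintro _ b hb ⟨a, ha, rfl⟩
  obtain ⟨b, rfl, hb⟩ := WithTop.le_coe_iff.1 hb
  exact ⟨b, hQ (WithTop.coe_le_coe.1 hb) ha, rfl⟩

lemma isLowerSet_diff_of_maximal {Q : Set P} (hQ : IsLowerSet Q) {t : P}
    (ht : Maximal (· ∈ Q) t) : IsLowerSet (Q \ {t}) := by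
  rintro a b hba ⟨ha, hat⟩
  refine ⟨hQ hba ha, ?_⟩
  rintro rfl
  exact hat (ht.eq_of_le ha hba).symm

/-- Enlarging an interval lowers x, which stays in the ideal, and raises y, which stays outside it.
-/
lemma isLowerSet_range_bierEmbedding {Q : Set P} (hQ : IsLowerSet Q) :
    IsLowerSet (Set.range (bierEmbedding Q)) := by
  intro p q hqp hp
  rw [mem_range_bierEmbedding] at hp ⊢
  obtain ⟨h1, h2, h3⟩ := hp
  have hq1 : q.1 ≤ p.1 := hqp.1
  have hq2 : ofDual p.2 ≤ ofDual q.2 := hqp.2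
  exact ⟨isLowerSet_image_coe hQ hq1 h1, fun h => h2 (isLowerSet_image_coe hQ hq2 h),
    hq1.trans (h3.trans hq2)⟩

lemma posetRank_bier [OrderBot P] [Finite P] (hP : IsEulerian (WithTop P)) {Q : Set P}
    (hQ : IsLowerSet Q) (hne : Q.Nonempty) :
    posetRank (Bier P Q) = elemRank (⊤ : WithTop P) - 1 := by
  have hr (s : Bier P Q) : elemRank s = elemRank (ofDual s.1).fst +
      (elemRank (⊤ : WithTop P) - elemRank (ofDual s.1).snd) := by
    rw [elemRank_orderEmbedding _ (isLowerSet_range_bierEmbedding hQ) s, elemRank_prod,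
      ← hP.elemRank_toDual]
    rfl
  refine posetRank_eq (fun s => ?_) ?_
  · have hlt : (ofDual s.1).fst < (ofDual s.1).snd :=
      lt_of_le_of_ne (ofDual s.1).fst_le_snd fun h => s.2.2 (h ▸ s.2.1)
    have h1 := elemRank_lt hlt
    have h2 := elemRank_mono (le_top (a := (ofDual s.1).snd))
    rw [hr]
    omega
  -- The rank is attained at a cover x ⋖ y; maximality of `x` in `Q` keeps `y` outside `Q`.
  · obtain ⟨x, hx⟩ := Q.toFinite.exists_maximal hne
    obtain ⟨y, hy⟩ := exists_covBy_of_wellFoundedLT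
      (not_isMax_iff_ne_top.2 (WithTop.coe_ne_top (a := x)))
    have hyQ : y ∉ ((↑) : P → WithTop P) '' Q := by
      rintro ⟨z, hz, rfl⟩
      exact hx.not_gt hz (WithTop.coe_lt_coe.1 hy.lt)
    refine ⟨⟨toDual ⟨((x : WithTop P), y), hy.le⟩, ⟨x, hx.prop, rfl⟩, hyQ⟩, ?_⟩
    have h1 := hP.graded _ _ hy
    have h2 := elemRank_mono (le_top (a := y))
    rw [hr]
    simp only [ofDual_toDual]
    omega

open Classical in
lemma toricF_bier [OrderBot P] [Finite P] [Fintype (WithTop P)] (hP : IsEulerian (WithTop P))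
    {Q : Set P} (hQ : IsLowerSet Q) (hne : Q.Nonempty) :
    toricF (Bier P Q) = ∑ x : WithTop P, ∑ y : WithTop P,
      if x ∈ ((↑) : P → WithTop P) '' Q ∧ y ∉ ((↑) : P → WithTop P) '' Q ∧ x ≤ y then
        toricG (Set.Iio x) * toricG (Set.Iio (toDual y)) * (X - 1) ^ (elemRank y - 1 - elemRank x)
      else 0 := by
  have : Fintype (WithTop P)ᵒᵈ := Fintype.ofFinite _
  have : Nonempty (Bier P Q) := by
    obtain ⟨x, hx⟩ := hne
    exact ⟨⟨toDual ⟨((x : WithTop P), ⊤), le_top⟩, ⟨x, hx, rfl⟩, by simp⟩⟩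
  rw [toricF_eq_sum_of_orderEmbedding (bierEmbedding Q) (isLowerSet_range_bierEmbedding hQ),
    Finset.sum_filter, Fintype.sum_prod_type]
  refine Fintype.sum_congr _ _ fun x => Fintype.sum_equiv ofDual _ _ fun y => ?_
  refine ite_congr (propext mem_range_bierEmbedding) (fun h => ?_) fun _ => rfl
  have hy : elemRank y = elemRank (⊤ : WithTop P) - elemRank (ofDual y) :=
    hP.elemRank_toDual (ofDual y)
  have hle := elemRank_mono (le_top (a := ofDual y))
  rw [toricG_Iio_prod hP.isLocallyEulerian hP.isLocallyEulerian_dual, elemRank_prod,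
    posetRank_bier hP hQ hne, hy, show elemRank (⊤ : WithTop P) - 1 - (elemRank x +
      (elemRank (⊤ : WithTop P) - elemRank (ofDual y))) = elemRank (ofDual y) - 1 - elemRank x by
      omega]
  rfl

lemma toricF_bier_diff_sub_toricF_bier [OrderBot P] [Finite P] (hP : IsEulerian (WithTop P))
    {Q : Set P} (hQ : IsLowerSet Q) {t : P} (ht : Maximal (· ∈ Q) t) (hbot : t ≠ ⊥) :
    toricF (Bier P (Q \ {t})) - toricF (Bier P Q) =
      toricF (Set.Iio (t : WithTop P)) * toricG (Set.Iio (toDual (t : WithTop P))) -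
        toricG (Set.Iio (t : WithTop P)) * toricF (Set.Iio (toDual (t : WithTop P))) := by
  classical
  have : Fintype (WithTop P) := Fintype.ofFinite _
  have : Fintype (WithTop P)ᵒᵈ := Fintype.ofFinite _
  have hbQ : ⊥ ∈ Q := hQ bot_le ht.prop
  have hQt := isLowerSet_diff_of_maximal hQ ht
  have hmint : ¬ IsMin (t : WithTop P) :=
    not_isMin_iff.2 ⟨((⊥ : P) : WithTop P), WithTop.coe_lt_coe.2 (bot_lt_iff_ne_bot.2 hbot)⟩
  have hmint' : ¬ IsMin (toDual (t : WithTop P)) :=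
    not_isMin_iff.2 ⟨toDual ⊤, WithTop.coe_lt_top t⟩
  rw [toricF_bier hP hQt ⟨⊥, hbQ, hbot.symm⟩, toricF_bier hP hQ ⟨⊥, hbQ⟩]
  let T (x y : WithTop P) : ℤ[X] :=
    toricG (Set.Iio x) * toricG (Set.Iio (toDual y)) * (X - 1) ^ (elemRank y - 1 - elemRank x)
  have htQ : (t : WithTop P) ∈ ((↑) : P → WithTop P) '' Q := ⟨t, ht.prop, rfl⟩
  have hmem (x : WithTop P) : x ∈ ((↑) : P → WithTop P) '' (Q \ {t}) ↔
      x ∈ ((↑) : P → WithTop P) '' Q ∧ x ≠ t := by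
    rw [Set.image_sdiff WithTop.coe_injective, Set.image_singleton]
    rfl
  have hlow {x : WithTop P} (h : x < t) : x ∈ ((↑) : P → WithTop P) '' Q :=
    isLowerSet_image_coe hQ h.le htQ
  have hup {y : WithTop P} (h : t < y) : y ∉ ((↑) : P → WithTop P) '' Q := by
    rintro ⟨z, hz, rfl⟩
    exact ht.not_gt hz (WithTop.coe_lt_coe.1 h)
  -- The two index sets differ only in pairs with y = t, which are gained, and pairs with x = t,
  -- which are lost; (t, t) is in neither.
  have hpoint (x y : WithTop P) :
      ((if x ∈ ((↑) : P → WithTop P) '' (Q \ {t}) ∧ y ∉ ((↑) : P → WithTop P) '' (Q \ {t}) ∧ x ≤ y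
        then T x y else 0) -
      if x ∈ ((↑) : P → WithTop P) '' Q ∧ y ∉ ((↑) : P → WithTop P) '' Q ∧ x ≤ y
        then T x y else 0) =
      (if y = t then if x < t then T x t else 0 else 0) -
        if x = t then if t < y then T t y else 0 else 0 := by
    simp only [hmem]
    by_cases hx : x = t
    · subst hx
      by_cases hy : (t : WithTop P) < y
      · simp [hy, hy.le, hup hy, htQ, hy.ne']
      · have : ¬ (y ∉ ((↑) : P → WithTop P) '' Q ∧ (t : WithTop P) ≤ y) := by
          rintro ⟨h1, h2⟩
          rcases h2.eq_or_lt with h | h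
          exacts [h1 (h ▸ htQ), hy h]
        rw [if_neg (by simp), if_neg fun h => this h.2]
        simp [hy]
    · by_cases hy : y = t
      · subst hy
        by_cases hxt : x < t
        · simp [hxt, hxt.le, hlow hxt, htQ, hx]
        · have : ¬ x ≤ t := fun h => hxt (lt_of_le_of_ne h hx)
          simp [hxt, this, htQ, hx]
      · simp [hx, hy]
  change (∑ x : WithTop P, ∑ y : WithTop P, ite _ (T x y) _) -
    (∑ x : WithTop P, ∑ y : WithTop P, ite _ (T x y) _) = _
  rw [← Finset.sum_sub_distrib]
  simp only [← Finset.sum_sub_distrib, hpoint]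
  simp only [Finset.sum_sub_distrib]
  congr 1
  · simp only [Finset.sum_ite_eq', Finset.mem_univ, if_true]
    rw [toricF_Iio hmint, Finset.sum_mul, Finset.sum_filter]
    refine Fintype.sum_congr _ _ fun x => ?_
    by_cases h : x < t
    · rw [if_pos h, if_pos h]
      simp only [T]
      ring
    · rw [if_neg h, if_neg h]
  · rw [Finset.sum_comm]
    simp only [Finset.sum_ite_eq', Finset.mem_univ, if_true]
    rw [toricF_Iio hmint', Finset.mul_sum, Finset.sum_filter]
    refine (Fintype.sum_equiv ofDual _ _ fun y => ?_).symm
    refine ite_congr rfl (fun h => ?_) fun _ => rfl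
    have h1 : elemRank y = elemRank (⊤ : WithTop P) - elemRank (ofDual y) :=
      hP.elemRank_toDual (ofDual y)
    have h2 := elemRank_mono (le_top (a := ofDual y))
    have h3 := elemRank_lt (show (t : WithTop P) < ofDual y from h)
    simp only [T]
    rw [hP.elemRank_toDual, h1, show elemRank (⊤ : WithTop P) - elemRank (t : WithTop P) - 1 -
      (elemRank (⊤ : WithTop P) - elemRank (ofDual y)) =
        elemRank (ofDual y) - 1 - elemRank (t : WithTop P) by omega, ← mul_assoc]
    rfl

/-- The half-open interval `[0̂, t)` of `P` is the lower interval of `t` in `P̂`. -/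
def icoBotIso [OrderBot P] (t : P) : Set.Ico ⊥ t ≃o Set.Iio (t : WithTop P) where
  toEquiv := Equiv.ofBijective (fun x => ⟨(x : P), WithTop.coe_lt_coe.2 x.2.2⟩)
    ⟨fun x y h => Subtype.ext (WithTop.coe_injective (congrArg Subtype.val h)), fun y => by
      obtain ⟨z, hz, hzt⟩ := WithTop.lt_iff_exists_coe.1 (show (y : WithTop P) < t from y.2)
      exact ⟨⟨z, bot_le, WithTop.coe_lt_coe.1 (hz ▸ y.2)⟩, Subtype.ext hz.symm⟩⟩
  map_rel_iff' := WithTop.coe_le_coe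

/-- The opposite of `(t, 1̂]` is the lower interval of `t` in the opposite poset. -/
def ioiDualIso {A : Type*} [PartialOrder A] (t : A) : (Set.Ioi t)ᵒᵈ ≃o Set.Iio (toDual t) where
  toFun x := ⟨toDual (ofDual x).1, (ofDual x).2⟩
  invFun x := toDual ⟨ofDual x.1, x.2⟩
  left_inv _ := rfl
  right_inv _ := rfl
  map_rel_iff' := Iff.rfl

theorem toricH_bier_diff_sub_toricH_bier [OrderBot P] [Finite P] (hP : IsEulerian (WithTop P))
    {Q : Set P} (hQ : IsLowerSet Q) {t : P} (ht : Maximal (· ∈ Q) t) (hbot : t ≠ ⊥) :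
    toricH (Bier P (Q \ {t})) - toricH (Bier P Q) =
      toricH (Set.Ico ⊥ t) * toricG (Set.Ioi (t : WithTop P))ᵒᵈ -
        toricG (Set.Ico ⊥ t) * toricH (Set.Ioi (t : WithTop P))ᵒᵈ := by
  have : Fintype (WithTop P) := Fintype.ofFinite _
  have : Fintype (WithTop P)ᵒᵈ := Fintype.ofFinite _
  have hbQ : ⊥ ∈ Q := hQ bot_le ht.prop
  have hQt := isLowerSet_diff_of_maximal hQ ht
  have hmint : ¬ IsMin (t : WithTop P) :=
    not_isMin_iff.2 ⟨((⊥ : P) : WithTop P), WithTop.coe_lt_coe.2 (bot_lt_iff_ne_bot.2 hbot)⟩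
  have hmint' : ¬ IsMin (toDual (t : WithTop P)) :=
    not_isMin_iff.2 ⟨toDual ⊤, WithTop.coe_lt_top t⟩
  have hE := hP.isLocallyEulerian
  have hE' := hP.isLocallyEulerian_dual
  rw [toricH_orderIso (icoBotIso t), toricG_orderIso (icoBotIso t),
    toricH_orderIso (ioiDualIso (t : WithTop P)), toricG_orderIso (ioiDualIso (t : WithTop P)),
    hE.toricH_Iio hmint, hE'.toricH_Iio hmint', toricH, toricH,
    posetRank_bier hP hQt ⟨⊥, hbQ, hbot.symm⟩, posetRank_bier hP hQ ⟨⊥, hbQ⟩, ← reflect_sub',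
    toricF_bier_diff_sub_toricF_bier hP hQ ht hbot, reflect_sub']
  have hF := hE.reflect_toricF hmint
  have hF' := hE'.reflect_toricF hmint'
  have hG := hE.reflect_toricG hmint
  have hG' := hE'.reflect_toricG hmint'
  have dF := natDegree_toricF_Iio_le hmint
  have dF' := natDegree_toricF_Iio_le hmint'
  have dG := natDegree_toricG_Iio_le (t : WithTop P)
  have dG' := natDegree_toricG_Iio_le (toDual (t : WithTop P))
  have hpos := elemRank_pos hmint
  have hpos' := elemRank_pos hmint'
  have hr := hP.elemRank_toDual (t : WithTop P)
  -- Each f is reversed in its own rank but each g in one degree more, so that the degrees add up to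
  -- r(1̂) - 1, the rank of both Bier posets.
  have h1 := reflect_mul _ _ dF (dG'.trans (show _ ≤ elemRank (toDual (t : WithTop P)) by omega))
  have h2 := reflect_mul _ _ (dG.trans (show _ ≤ elemRank (t : WithTop P) by omega)) dF'
  rw [show elemRank (t : WithTop P) - 1 + elemRank (toDual (t : WithTop P)) =
    elemRank (⊤ : WithTop P) - 1 by omega, hF, hG'] at h1
  rw [show elemRank (t : WithTop P) + (elemRank (toDual (t : WithTop P)) - 1) =
    elemRank (⊤ : WithTop P) - 1 by omega, hF', hG] at h2
  rw [h1, h2]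
  ring

end BierPoset

end

theorem lemma3p1 {k : Type v} [CommRing k] [Nontrivial k]
    {P : Type u} [PartialOrder P] [OrderBot P] [Finite P]
    (hP : IsGorensteinStar k P) (t : P) :
    (∀ Q : Set P, IsLowerSet Q → Q ≠ {⊥} → Maximal (· ∈ Q) t →
      toricH (Bier P (Q \ {t})) - toricH (Bier P Q) =
        toricH (Set.Ico ⊥ t) * toricG (Set.Ioi (t : WithTop P))ᵒᵈ -
          toricG (Set.Ico ⊥ t) * toricH (Set.Ioi (t : WithTop P))ᵒᵈ) ∧
    (∀ Q Q' : Set P, IsLowerSet Q → IsLowerSet Q' → Maximal (· ∈ Q) t → Maximal (· ∈ Q') t →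
      toricH (Bier P (Q \ {t})) - toricH (Bier P Q) =
        toricH (Bier P (Q' \ {t})) - toricH (Bier P Q')) := by
  have key : ∀ Q : Set P, IsLowerSet Q → Q ≠ {⊥} → Maximal (· ∈ Q) t →
      toricH (Bier P (Q \ {t})) - toricH (Bier P Q) =
        toricH (Set.Ico ⊥ t) * toricG (Set.Ioi (t : WithTop P))ᵒᵈ -
          toricG (Set.Ico ⊥ t) * toricH (Set.Ioi (t : WithTop P))ᵒᵈ := by
    intro Q hQ hne ht
    refine toricH_bier_diff_sub_toricH_bier hP.eulerian hQ ht ?_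
    rintro rfl
    exact hne (Set.eq_singleton_iff_unique_mem.2
      ⟨ht.prop, fun x hx => (ht.eq_of_le hx bot_le).symm⟩)
  refine ⟨key, fun Q Q' hQ hQ' ht ht' => ?_⟩
  -- Here the formula is not available, but a maximal 0̂ forces both ideals to be {0̂}.
  by_cases hbot : t = ⊥
  · subst hbot
    have hsing {R : Set P} (h : Maximal (· ∈ R) ⊥) : R = {⊥} :=
      Set.eq_singleton_iff_unique_mem.2 ⟨h.prop, fun x hx => (h.eq_of_le hx bot_le).symm⟩
    rw [hsing ht, hsing ht']
  · rw [toricH_bier_diff_sub_toricH_bier hP.eulerian hQ ht hbot,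
      toricH_bier_diff_sub_toricH_bier hP.eulerian hQ' ht' hbot]
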